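/- Let $\mathcal F=(F,<,+,\cdot,0,1,\dots)$ be a first-order structure expanding an ordered field. "Definable" means definable in $\mathcal F$ with parameters; $F$ carries the order topology, $F^k$ the product topology, and subsets of $F^k$ the subspace topology. A set $S\subseteq F^k$ is bounded if there is $c\in F$ with $|x_i|\le c$ for all $x\in S$ and all $i$. Assume that $\mathcal F$ is * definably complete: every definable subset of $F$ has a supremum and an infimum in $F\cup\{\pm\infty\}$; and * locally o-minimal: for every definable $S\subseteq F$ and every $a\in F$ there is an open interval $I\ni a$ such that $S\cap I$ is a finite union of points and open intervals (open intervals have endpoints in $F\cup\{\pm\infty\}$). Let $X\subseteq F^m$ and $Y\subseteq F^n$ be definable sets and let $f:X\to Y$ be a definable continuous map. Call $f$ definably proper if for every definable set $K\subseteq Y$ that is closed and bounded in $F^n$, the preimage $f^{-1}(K)$ is closed and bounded in $F^m$. Call $f$ a closed map (in the definable sense) if for every definable subset $C\subseteq X$ that is closed in $X$, the image $f(C)$ is closed in $Y$. Then $f$ is definably proper if and only if $f$ is a closed map in this sense and, for every $y\in Y$, the fibre $f^{-1}(y)$ is closed and bounded in $F^m$. -/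

import Mathlib

universe u v w

namespace LocallyOMinimal

open FirstOrder FirstOrder.Language

/-- The `L`-structure on the ordered field `F` is an expansion of the ordered field
`(F, <, +, ·, 0, 1)`: each of these symbols belongs to `L` and has its usual interpretation. -/
class IsOrderedFieldExpansion (L : FirstOrder.Language.{u, v}) (F : Type w) [Field F] [LinearOrder F]
    [L.Structure F] : Prop where
  exists_lt : ∃ r : L.Relations 2, ∀ x : Fin 2 → F, Structure.RelMap r x ↔ x 0 < x 1
  exists_add : ∃ g : L.Functions 2, ∀ x : Fin 2 → F, Structure.funMap g x = x 0 + x 1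
  exists_mul : ∃ g : L.Functions 2, ∀ x : Fin 2 → F, Structure.funMap g x = x 0 * x 1
  exists_zero : ∃ c : L.Functions 0, ∀ x : Fin 0 → F, Structure.funMap c x = 0
  exists_one : ∃ c : L.Functions 0, ∀ x : Fin 0 → F, Structure.funMap c x = 1

/-- Definable means definable with arbitrary parameters from `F`. -/
def IsDefinable (L : FirstOrder.Language.{u, v}) {F : Type w} [L.Structure F] {ι : Type}
    (S : Set (ι → F)) : Prop :=
  (Set.univ : Set F).Definable L S

/-- Definable (with parameters) subsets of `F` itself. -/
def IsDefinable₁ (L : FirstOrder.Language.{u, v}) {F : Type w} [L.Structure F] (S : Set F) : Prop :=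
  (Set.univ : Set F).Definable₁ L S

/-- Every definable subset of `F` has a supremum and an infimum in `F ∪ {±∞}`.
For the empty set and for sets unbounded in the relevant direction these exist trivially (they
are `±∞`), and for all other definable sets they have to exist in `F`. -/
def IsDefinablyComplete (L : FirstOrder.Language.{u, v}) (F : Type w) [LinearOrder F] [L.Structure F] :
    Prop :=
  ∀ S : Set F, IsDefinable₁ L S → S.Nonempty →
    (BddAbove S → ∃ s, IsLUB S s) ∧ (BddBelow S → ∃ s, IsGLB S s)

/-- Nonempty open intervals `(a, b)` with endpoints in `F ∪ {±∞}`, where `F` is densely ordered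
without endpoints. -/
def IsOpenInterval {F : Type w} [LinearOrder F] (I : Set F) : Prop :=
  (∃ a b : F, a < b ∧ I = Set.Ioo a b) ∨ (∃ a : F, I = Set.Ioi a) ∨ (∃ b : F, I = Set.Iio b) ∨
    I = Set.univ

/-- Finite unions of points and open intervals. -/
def IsFiniteUnion {F : Type w} [LinearOrder F] (S : Set F) : Prop :=
  ∃ 𝒰 : Set (Set F), 𝒰.Finite ∧ (∀ U ∈ 𝒰, (∃ a, U = {a}) ∨ IsOpenInterval U) ∧ S = ⋃₀ 𝒰

/-- Local o-minimality. -/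
def IsLocallyOMinimal (L : FirstOrder.Language.{u, v}) (F : Type w) [LinearOrder F] [L.Structure F] :
    Prop :=
  ∀ S : Set F, IsDefinable₁ L S → ∀ a : F,
    ∃ I : Set F, IsOpenInterval I ∧ a ∈ I ∧ IsFiniteUnion (S ∩ I)

section Maps

variable (L : FirstOrder.Language.{u, v}) {F : Type w} [L.Structure F] {m n : ℕ}
  {X : Set (Fin m → F)} {Y : Set (Fin n → F)}

/-- A map `X → Y` is definable when its graph, as a subset of `F^m × F^n`, is definable. -/
def IsDefinableMap (f : X → Y) : Prop :=
  IsDefinable L {z : Fin m ⊕ Fin n → F |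
    ∃ x : X, z ∘ Sum.inl = (x : Fin m → F) ∧ z ∘ Sum.inr = (f x : Fin n → F)}

/-- The set `S` is contained in a box `[-c, c]^k`. -/
def IsBoundedSet {F : Type w} [Field F] [LinearOrder F] {k : ℕ} (S : Set (Fin k → F)) : Prop :=
  ∃ c : F, ∀ x ∈ S, ∀ i, |x i| ≤ c

/-- The preimage `f⁻¹(K)`, as a subset of the ambient space `F^m`. -/
def preimageIn (f : X → Y) (K : Set (Fin n → F)) : Set (Fin m → F) :=
  {x | ∃ hx : x ∈ X, (f ⟨x, hx⟩ : Fin n → F) ∈ K}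

variable [Field F] [LinearOrder F] [TopologicalSpace F]

/-- For every definable `K ⊆ Y` that is closed and bounded in `F^n`, the inverse image `f⁻¹(K)` is
closed and bounded in `F^m`. -/
def IsDefinablyProper (f : X → Y) : Prop :=
  ∀ K : Set (Fin n → F), IsDefinable L K → K ⊆ Y → IsClosed K → IsBoundedSet K →
    IsClosed (preimageIn f K) ∧ IsBoundedSet (preimageIn f K)

/-- Closed maps in the definable category: the image of every definable closed subset of `X`
(closed in `X`) is closed in `Y`. -/
def IsDefinablyClosedMap (f : X → Y) : Prop :=
  ∀ C : Set X, IsDefinable L (Subtype.val '' C) → IsClosed C → IsClosed (f '' C)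

end Maps

end LocallyOMinimal

namespace LocallyOMinimal

open FirstOrder FirstOrder.Language Set Filter Topology

/-! Two facts replace compactness. First, a definable set in `F` is eventually decided on each side
of a point, so bounded definable functions of one variable have one-sided limits. Together with
definable choice, this gives every decreasing definable family of nonempty uniformly bounded sets a
common adherent point (`exists_forall_mem_closure`). Second, a point `y` of `closure B` outside a
definable `B` is the limit of a definable continuous curve in `B`, and the curve with `y` is closed
and bounded (`exists_isClosed_subset_insert`). The second fact needs no monotonicity theorem, only
continuity just to the right of a point (`eventually_continuousAt_nhdsGT`).

Proper implies closed: if `y` were adherent to `f(C)` but outside it, take such a `K ⊆ f(C) ∪ {y}`.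
Unlike a closed ball, `K` stays inside `Y`, so properness applies. The points of `C` in the closed
bounded set `f⁻¹(K)` with image near `y` then have a common adherent point, which lies in `C` and
maps to `y`.

Conversely, if closed sets shrinking with `r` all meet `f⁻¹(K)`, their images have a common adherent
point `y ∈ K`. As `f` is closed, the fibre of `y` meets all of them
(`IsDefinablyClosedMap.exists_fibre`). Small boxes about an adherent point, or neighbourhoods of
infinity, transfer closedness and boundedness from the fibres to `f⁻¹(K)`. -/

/-- A space that is identified with a finite Cartesian power of `F`. -/
class DefinableSpace (F : Type w) (E : Type w) where
  Index : Type
  finite_index : Finite Index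
  coord : E ≃ (Index → F)

namespace DefinableSpace

attribute [instance] finite_index

variable {F : Type w}

instance line : DefinableSpace F F := ⟨Fin 1, inferInstance, (Equiv.funUnique (Fin 1) F).symm⟩

instance power {κ : Type} [Finite κ] : DefinableSpace F (κ → F) := ⟨κ, ‹_›, Equiv.refl _⟩

instance prod {A B : Type w} [DefinableSpace F A] [DefinableSpace F B] : DefinableSpace F (A × B) :=
  ⟨Index F A ⊕ Index F B, inferInstance,
    (Equiv.prodCongr coord coord).trans (Equiv.sumArrowEquivProdArrow _ _ _).symm⟩

end DefinableSpace

open DefinableSpace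

/-! ### Calculus of definable predicates and maps, automated by `fun_prop` -/

section Calculus

variable {L : FirstOrder.Language.{u, v}} {F : Type w} [L.Structure F]
  {A B C D : Type w} [DefinableSpace F A] [DefinableSpace F B] [DefinableSpace F C]
  [DefinableSpace F D]

variable (L F) in
/-- Definable predicates on a power of `F`. -/
@[fun_prop]
def DefPred (P : A → Prop) : Prop :=
  IsDefinable L {x : Index F A → F | P (coord.symm x)}

variable (L F) in
/-- Definable maps between powers of `F`. -/
@[fun_prop]
def DefMap (g : A → B) : Prop :=
  DefPred L F fun p : A × B => g p.1 = p.2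

variable (F) in
/-- Maps that select and rearrange coordinates. -/
def CoordMap (g : A → B) : Prop :=
  ∃ σ : Index F B → Index F A, ∀ x, coord (g x) = coord x ∘ σ

theorem CoordMap.id : CoordMap F (fun x : A => x) := ⟨_root_.id, fun _ => rfl⟩

theorem CoordMap.fst {g : C → A × B} (hg : CoordMap F g) : CoordMap F fun x => (g x).1 := by
  obtain ⟨σ, hσ⟩ := hg
  exact ⟨σ ∘ Sum.inl, fun x => by rw [← Function.comp_assoc, ← hσ]; rfl⟩

theorem CoordMap.snd {g : C → A × B} (hg : CoordMap F g) : CoordMap F fun x => (g x).2 := by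
  obtain ⟨σ, hσ⟩ := hg
  exact ⟨σ ∘ Sum.inr, fun x => by rw [← Function.comp_assoc, ← hσ]; rfl⟩

theorem CoordMap.prodMk {g : C → A} {h : C → B} (hg : CoordMap F g) (hh : CoordMap F h) :
    CoordMap F fun x => (g x, h x) := by
  obtain ⟨σ, hσ⟩ := hg
  obtain ⟨τ, hτ⟩ := hh
  refine ⟨Sum.elim σ τ, fun x => ?_⟩
  rw [Sum.comp_elim, ← hσ, ← hτ]
  rfl

theorem DefPred.comp_coordMap {P : B → Prop} (hP : DefPred L F P) {g : A → B}
    (hg : CoordMap F g) : DefPred L F fun x => P (g x) := by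
  obtain ⟨σ, hσ⟩ := hg
  have := Set.Definable.preimage_comp σ hP
  unfold DefPred IsDefinable
  convert this using 1
  ext x
  have := hσ (coord.symm x)
  simp only [Equiv.apply_symm_apply] at this
  simp [← this]

@[fun_prop]
theorem DefPred.and {P Q : A → Prop} (hP : DefPred L F P) (hQ : DefPred L F Q) :
    DefPred L F fun x => P x ∧ Q x := Set.Definable.inter hP hQ

@[fun_prop]
theorem DefPred.or {P Q : A → Prop} (hP : DefPred L F P) (hQ : DefPred L F Q) :
    DefPred L F fun x => P x ∨ Q x := Set.Definable.union hP hQ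

@[fun_prop]
theorem DefPred.not {P : A → Prop} (hP : DefPred L F P) : DefPred L F fun x => ¬ P x :=
  Set.Definable.compl hP

theorem DefPred.imp {P Q : A → Prop} (hP : DefPred L F P) (hQ : DefPred L F Q) :
    DefPred L F fun x => P x → Q x := by
  simpa only [imp_iff_not_or] using hP.not.or hQ

@[fun_prop]
theorem DefPred.exists {P : A → B → Prop} (hP : DefPred L F fun p : A × B => P p.1 p.2) :
    DefPred L F fun x => ∃ y, P x y := by
  have := Set.Definable.exists_of_finite hP
  unfold DefPred IsDefinable
  convert this using 1
  ext x
  exact coord.exists_congr_left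

theorem DefPred.forall {P : A → B → Prop} (hP : DefPred L F fun p : A × B => P p.1 p.2) :
    DefPred L F fun x => ∀ y, P x y := by
  simpa only [not_exists, not_not] using (DefPred.exists (P := fun x y => ¬ P x y) hP.not).not

theorem DefPred.forall_finite {κ : Type*} [Finite κ] {P : A → κ → Prop}
    (hP : ∀ i, DefPred L F fun x => P x i) : DefPred L F fun x => ∀ i, P x i := by
  have := Set.definable_iInter_of_finite hP
  simpa only [DefPred, IsDefinable, Set.ofPred_forall] using this

@[fun_prop]
theorem DefPred.exists_finite {κ : Type*} [Finite κ] {P : A → κ → Prop}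
    (hP : ∀ i, DefPred L F fun x => P x i) : DefPred L F fun x => ∃ i, P x i := by
  simpa only [not_forall, not_not] using
    (DefPred.forall_finite (P := fun x i => ¬ P x i) fun i => (hP i).not).not

@[fun_prop]
theorem DefPred.funProp_imp {P Q : A → Prop} (hP : DefPred L F P) (hQ : DefPred L F Q) :
    DefPred L F fun x => Mathlib.Meta.FunProp.Forall fun _ : P x => Q x := hP.imp hQ

@[fun_prop]
theorem DefPred.funProp_forall {P : A → B → Prop} (hP : DefPred L F fun p : A × B => P p.1 p.2) :
    DefPred L F fun x => Mathlib.Meta.FunProp.Forall fun y => P x y := .forall hP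

@[fun_prop]
theorem DefPred.funProp_forall_finite {κ : Type*} [Finite κ] {P : A → κ → Prop}
    (hP : ∀ i, DefPred L F fun x => P x i) :
    DefPred L F fun x => Mathlib.Meta.FunProp.Forall fun i => P x i := .forall_finite hP

theorem DefPred.diagonal : DefPred L F fun p : A × A => p.1 = p.2 := by
  have (i : Index F A) : DefPred L F fun p : A × A => coord (F := F) p.1 i = coord (F := F) p.2 i := by
    refine ⟨(Term.var (Sum.inl i)).equal (Term.var (Sum.inr i)), ?_⟩
    ext x
    have (z : Index F A → F) (j) : coord (coord.symm z : A) j = z j := by simp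
    exact (Eq.congr (this (x ∘ Sum.inl) i) (this (x ∘ Sum.inr) i)).trans Iff.rfl
  simpa only [← funext_iff, coord.apply_eq_iff_eq] using DefPred.forall_finite this

theorem CoordMap.comp {g : B → C} {h : A → B} (hg : CoordMap F g) (hh : CoordMap F h) :
    CoordMap F fun x => g (h x) := by
  obtain ⟨σ, hσ⟩ := hg
  obtain ⟨τ, hτ⟩ := hh
  exact ⟨τ ∘ σ, fun x => by rw [hσ, hτ]; rfl⟩

theorem CoordMap.defMap {g : A → B} (hg : CoordMap F g) : DefMap L F g :=
  DefPred.diagonal.comp_coordMap ((hg.comp CoordMap.id.fst).prodMk CoordMap.id.snd)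

/-- The graph turns substitution into a projection: `P (g x)` says that some `y` satisfies `g x = y`
and `P y`. -/
theorem DefPred.comp {P : B → Prop} (hP : DefPred L F P) {g : A → B} (hg : DefMap L F g) :
    DefPred L F fun x => P (g x) := by
  have : DefPred L F fun x => ∃ y, g x = y ∧ P y :=
    .exists (hg.and (hP.comp_coordMap CoordMap.id.snd))
  simpa using this

@[fun_prop]
theorem DefMap.id : DefMap L F fun x : A => x := CoordMap.id.defMap

@[fun_prop]
theorem DefMap.const (b : B) : DefMap L F fun _ : A => b := by
  have : DefPred L F fun y : B => b = y := by
    have (i : Index F B) : DefPred L F fun y : B => coord (F := F) b i = coord (F := F) y i := by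
      refine ⟨(L.con (⟨coord b i, mem_univ _⟩ : (univ : Set F))).term.equal (Term.var i), ?_⟩
      ext x
      have (z : Index F B → F) (j) : coord (coord.symm z : B) j = z j := by simp
      refine (Eq.congr rfl (this x i)).trans (Iff.trans ?_ Formula.realize_equal.symm)
      simp
    simpa only [← funext_iff, coord.apply_eq_iff_eq] using DefPred.forall_finite this
  exact this.comp_coordMap CoordMap.id.snd

@[fun_prop]
theorem DefMap.comp {g : B → C} {h : A → B} (hg : DefMap L F g) (hh : DefMap L F h) :
    DefMap L F fun x => g (h x) := by
  have : DefPred L F fun p : A × C => ∃ y, h p.1 = y ∧ g y = p.2 :=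
    .exists ((hh.comp_coordMap (CoordMap.id.fst.fst.prodMk CoordMap.id.snd)).and
      (hg.comp_coordMap (CoordMap.id.snd.prodMk CoordMap.id.fst.snd)))
  simpa [DefMap] using this

@[fun_prop]
theorem DefMap.fst {g : C → A × B} (hg : DefMap L F g) : DefMap L F fun x => (g x).1 :=
  CoordMap.id.fst.defMap.comp hg

@[fun_prop]
theorem DefMap.snd {g : C → A × B} (hg : DefMap L F g) : DefMap L F fun x => (g x).2 :=
  CoordMap.id.snd.defMap.comp hg

@[fun_prop]
theorem DefMap.prodMk {g : C → A} {h : C → B} (hg : DefMap L F g) (hh : DefMap L F h) :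
    DefMap L F fun x => (g x, h x) := by
  have := (hg.comp_coordMap (CoordMap.id.fst.prodMk CoordMap.id.snd.fst)).and
    (hh.comp_coordMap (A := C × A × B) (CoordMap.id.fst.prodMk CoordMap.id.snd.snd))
  simpa [DefMap, Prod.ext_iff] using this

@[fun_prop]
theorem DefMap.apply {κ : Type} [Finite κ] (i : κ) : DefMap L F fun x : κ → F => x i :=
  CoordMap.defMap ⟨fun _ => i, fun _ => rfl⟩

@[fun_prop]
theorem DefMap.pi {κ : Type} [Finite κ] {g : A → κ → F} (hg : ∀ i, DefMap L F fun x => g x i) :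
    DefMap L F g := by
  have (i : κ) : CoordMap F fun x : κ → F => x i := ⟨fun _ => i, fun _ => rfl⟩
  have : DefPred L F fun p : A × (κ → F) => ∀ i, g p.1 i = p.2 i :=
    .forall_finite fun i => (hg i).comp_coordMap
      (CoordMap.id.fst.prodMk ((this i).comp CoordMap.id.snd))
  simpa only [DefMap, funext_iff] using this

@[fun_prop]
theorem DefPred.eq {g h : A → B} (hg : DefMap L F g) (hh : DefMap L F h) :
    DefPred L F fun x => g x = h x :=
  DefPred.diagonal.comp (hg.prodMk hh)

variable (L F) in
/-- Definable subsets of a power of `F`. -/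
def DefSet (S : Set A) : Prop :=
  DefPred L F fun x => x ∈ S

theorem DefPred.defSet {P : A → Prop} (hP : DefPred L F P) : DefSet L F {x | P x} := hP

@[fun_prop]
theorem DefPred.mem {S : Set B} {g : A → B} (hS : DefSet L F S) (hg : DefMap L F g) :
    DefPred L F fun x => g x ∈ S :=
  DefPred.comp hS hg

@[fun_prop]
theorem DefMap.ite {P : A → Prop} [DecidablePred P] {g h : A → B} (hP : DefPred L F P) (hg : DefMap L F g)
    (hh : DefMap L F h) : DefMap L F fun x => if P x then g x else h x := by
  have : DefPred L F fun p : A × B => (P p.1 → g p.1 = p.2) ∧ (¬ P p.1 → h p.1 = p.2) :=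
    .and (.imp (hP.comp (by fun_prop)) (by fun_prop))
      (.imp (.not (hP.comp (by fun_prop))) (by fun_prop))
  unfold DefMap
  convert this using 2 with p
  by_cases h : P p.1 <;> simp [h]

/-- A definable single-valued relation is contained in the graph of a definable map. -/
theorem exists_defMap_of_unique [Nonempty B] {R : Set (A × B)} (hR : DefSet L F R)
    (huniq : ∀ a b b', (a, b) ∈ R → (a, b') ∈ R → b = b') :
    ∃ g : A → B, DefMap L F g ∧ ∀ a b, (a, b) ∈ R → g a = b := by
  classical
  obtain ⟨b₀⟩ := ‹Nonempty B›
  -- Where the relation has no value the map takes the default `b₀`, which is allowed as a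
  -- parameter.
  refine ⟨fun a => if h : ∃ b, (a, b) ∈ R then h.choose else b₀, ?_, fun a b hab => ?_⟩
  · have : DefPred L F fun p : A × B => p ∈ R ∨ (¬ ∃ b, (p.1, b) ∈ R) ∧ b₀ = p.2 := by
      fun_prop (disch := assumption)
    unfold DefMap
    convert this using 2 with p
    by_cases h : ∃ b, (p.1, b) ∈ R
    · simp only [h, dite_true, not_true, false_and, or_false]
      refine ⟨fun e => ?_, huniq _ _ _ h.choose_spec⟩
      have := h.choose_spec
      rwa [e] at this
    · have : p ∉ R := fun hp => h ⟨p.2, hp⟩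
      simp [h, this]
  · have h : ∃ b, (a, b) ∈ R := ⟨b, hab⟩
    simp only [h, dite_true]
    exact huniq _ _ _ h.choose_spec hab

theorem DefMap.of_function {o : F → F → F}
    (ho : ∃ c : L.Functions 2, ∀ x : Fin 2 → F, Structure.funMap c x = o (x 0) (x 1)) :
    DefMap L F fun p : F × F => o p.1 p.2 := by
  obtain ⟨c, hc⟩ := ho
  have : IsDefinable L {x : (Fin 1 ⊕ Fin 1) ⊕ Fin 1 → F |
      o (x (Sum.inl (Sum.inl 0))) (x (Sum.inl (Sum.inr 0))) = x (Sum.inr 0)} := by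
    refine ⟨(Functions.apply₂ ((L.lhomWithConstants (univ : Set F)).onFunction c)
      (Term.var (Sum.inl (Sum.inl 0))) (Term.var (Sum.inl (Sum.inr 0)))).equal
      (Term.var (Sum.inr 0)), ?_⟩
    ext x
    refine Iff.trans ?_ Formula.realize_equal.symm
    rw [Term.realize_functions_apply₂, LHom.map_onFunction, hc]
    rfl
  exact this

end Calculus

/-! ### Definability of the order and the field operations -/

section Field

variable {L : FirstOrder.Language.{u, v}} {F : Type w} [L.Structure F] [Field F] [LinearOrder F]
  [IsOrderedFieldExpansion L F] {A : Type w} [DefinableSpace F A]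

@[fun_prop]
theorem DefPred.lt {g h : A → F} (hg : DefMap L F g) (hh : DefMap L F h) :
    DefPred L F fun x => g x < h x := by
  have : DefPred L F fun p : F × F => p.1 < p.2 := by
    obtain ⟨r, hr⟩ := IsOrderedFieldExpansion.exists_lt (L := L) (F := F)
    refine ⟨Relations.formula₂ ((LHom.sumInl : L →ᴸ L[[univ]]).onRelation r)
      (Term.var (Sum.inl (0 : Fin 1))) (Term.var (Sum.inr (0 : Fin 1))), ?_⟩
    ext x
    refine Iff.trans ?_ Formula.realize_rel₂.symm
    simp [hr]
    rfl
  exact this.comp (hg.prodMk hh)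

@[fun_prop]
theorem DefMap.add {g h : A → F} (hg : DefMap L F g) (hh : DefMap L F h) :
    DefMap L F fun x => g x + h x :=
  (DefMap.of_function (o := (· + ·)) IsOrderedFieldExpansion.exists_add).comp (hg.prodMk hh)

@[fun_prop]
theorem DefMap.mul {g h : A → F} (hg : DefMap L F g) (hh : DefMap L F h) :
    DefMap L F fun x => g x * h x :=
  (DefMap.of_function (o := (· * ·)) IsOrderedFieldExpansion.exists_mul).comp (hg.prodMk hh)

@[fun_prop]
theorem DefMap.neg {g : A → F} (hg : DefMap L F g) : DefMap L F fun x => - g x := by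
  have : DefMap L F fun x => (-1) * g x := by fun_prop
  simpa using this

@[fun_prop]
theorem DefMap.sub {g h : A → F} (hg : DefMap L F g) (hh : DefMap L F h) :
    DefMap L F fun x => g x - h x := by
  simpa only [sub_eq_add_neg] using hg.add hh.neg

@[fun_prop]
theorem DefMap.sum {κ : Type*} (s : Finset κ) {g : A → κ → F}
    (hg : ∀ i, DefMap L F fun x => g x i) : DefMap L F fun x => ∑ i ∈ s, g x i := by
  classical
  induction s using Finset.induction_on with
  | empty => simpa using DefMap.const 0
  | insert i s hi ih => simpa only [Finset.sum_insert hi] using (hg i).add ih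

@[fun_prop]
theorem DefPred.le {g h : A → F} (hg : DefMap L F g) (hh : DefMap L F h) :
    DefPred L F fun x => g x ≤ h x := by
  simpa only [not_lt] using (DefPred.lt hh hg).not

@[fun_prop]
theorem DefMap.abs [IsStrictOrderedRing F] {g : A → F} (hg : DefMap L F g) :
    DefMap L F fun x => |g x| := by
  have : DefMap L F fun x => if 0 ≤ g x then g x else - g x := by fun_prop
  convert this using 2 with x
  split_ifs with h
  · exact abs_of_nonneg h
  · exact abs_of_neg (not_le.1 h)

end Field

/-! ### One-sided filters and the local o-minimality dichotomy -/

section OneSided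

variable {F : Type w} [LinearOrder F]

/-- A filter along which every definable set is eventually decided in the presence of local
o-minimality: it converges to `a` and does not oscillate around any point. -/
structure IsOneSided [TopologicalSpace F] (l : Filter F) (a : F) : Prop where
  le_nhds : l ≤ 𝓝 a
  lt_or_gt : ∀ b, (∀ᶠ t in l, t < b) ∨ ∀ᶠ t in l, b < t

variable [TopologicalSpace F]

theorem IsOneSided.eventually_of_isOpenInterval {l : Filter F} {a : F} (hl : IsOneSided l a)
    {U : Set F} (hU : IsOpenInterval U) : (∀ᶠ t in l, t ∈ U) ∨ ∀ᶠ t in l, t ∉ U := by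
  have hi (b : F) : (∀ᶠ t in l, t ∈ Ioi b) ∨ ∀ᶠ t in l, t ∉ Ioi b :=
    (hl.lt_or_gt b).symm.imp_right fun h => h.mono fun t ht => ht.not_gt
  have hj (b : F) : (∀ᶠ t in l, t ∈ Iio b) ∨ ∀ᶠ t in l, t ∉ Iio b :=
    (hl.lt_or_gt b).imp_right fun h => h.mono fun t ht => ht.not_gt
  rcases hU with ⟨p, q, -, rfl⟩ | ⟨p, rfl⟩ | ⟨q, rfl⟩ | rfl
  · rcases hi p with h1 | h1
    · rcases hj q with h2 | h2
      · exact .inl (h1.and h2)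
      · exact .inr (h2.mono fun t ht h => ht h.2)
    · exact .inr (h1.mono fun t ht h => ht h.1)
  · exact hi p
  · exact hj q
  · exact .inl (.of_forall fun _ => mem_univ _)

theorem IsOneSided.eventually_of_isFiniteUnion {l : Filter F} {a : F} (hl : IsOneSided l a)
    {S : Set F} (hS : IsFiniteUnion S) : (∀ᶠ t in l, t ∈ S) ∨ ∀ᶠ t in l, t ∉ S := by
  obtain ⟨𝒰, hfin, h𝒰, rfl⟩ := hS
  by_cases h : ∃ U ∈ 𝒰, ∀ᶠ t in l, t ∈ U
  · obtain ⟨U, hU, h⟩ := h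
    exact .inl (h.mono fun t ht => mem_sUnion_of_mem ht hU)
  · push Not at h
    have : ∀ᶠ t in l, ∀ U ∈ 𝒰, t ∉ U := by
      refine (eventually_all_finite hfin).2 fun U hU => ?_
      rcases h𝒰 U hU with ⟨b, rfl⟩ | hI
      · rcases hl.lt_or_gt b with h | h
        · exact h.mono fun t ht => ht.ne
        · exact h.mono fun t ht => ht.ne'
      · exact (hl.eventually_of_isOpenInterval hI).resolve_left (not_eventually.2 (h U hU))
    exact .inr (this.mono fun t ht ⟨U, hU, htU⟩ => ht U hU htU)

variable [OrderTopology F]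

theorem isOneSided_nhdsGT (a : F) : IsOneSided (𝓝[>] a) a := by
  refine ⟨nhdsWithin_le_nhds, fun b => ?_⟩
  rcases le_or_gt b a with h | h
  · exact .inr (eventually_mem_nhdsWithin.mono fun t ht => h.trans_lt ht)
  · exact .inl (nhdsWithin_le_nhds (Iio_mem_nhds h))

theorem isOneSided_nhdsLT (a : F) : IsOneSided (𝓝[<] a) a := by
  refine ⟨nhdsWithin_le_nhds, fun b => ?_⟩
  rcases le_or_gt a b with h | h
  · exact .inl (eventually_mem_nhdsWithin.mono fun t ht => ht.trans_le h)
  · exact .inr (nhdsWithin_le_nhds (Ioi_mem_nhds h))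

theorem IsOpenInterval.isOpen {U : Set F} (hU : IsOpenInterval U) : IsOpen U := by
  rcases hU with ⟨p, q, -, rfl⟩ | ⟨p, rfl⟩ | ⟨q, rfl⟩ | rfl
  exacts [isOpen_Ioo, isOpen_Ioi, isOpen_Iio, isOpen_univ]

theorem IsLocallyOMinimal.eventually_mem_or_notMem {L : FirstOrder.Language.{u, v}}
    [L.Structure F] (hlocal : IsLocallyOMinimal L F) {l : Filter F} {a : F}
    (hl : IsOneSided l a) {S : Set F} (hS : DefSet L F S) :
    (∀ᶠ t in l, t ∈ S) ∨ ∀ᶠ t in l, t ∉ S := by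
  obtain ⟨I, hI, ha, hSI⟩ := hlocal S hS a
  have hIl : ∀ᶠ t in l, t ∈ I := hl.le_nhds (hI.isOpen.mem_nhds ha)
  rcases hl.eventually_of_isFiniteUnion hSI with h | h
  · exact .inl (h.mono fun t ht => ht.1)
  · exact .inr ((h.and hIl).mono fun t ht hS => ht.1 ⟨hS, ht.2⟩)

theorem IsLocallyOMinimal.eventually_of_frequently {L : FirstOrder.Language.{u, v}}
    [L.Structure F] (hlocal : IsLocallyOMinimal L F) {l : Filter F} {a : F}
    (hl : IsOneSided l a) {S : Set F} (hS : DefSet L F S) (h : ∃ᶠ t in l, t ∈ S) :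
    ∀ᶠ t in l, t ∈ S :=
  (hlocal.eventually_mem_or_notMem hl hS).resolve_right h

end OneSided

section Filters

variable {F : Type w} [LinearOrder F] [NoMaxOrder F] [TopologicalSpace F] [OrderTopology F]

theorem eventually_nhdsGT {a : F} {P : F → Prop} :
    (∀ᶠ t in 𝓝[>] a, P t) ↔ ∃ b, a < b ∧ ∀ t, a < t → t < b → P t := by
  refine mem_nhdsGT_iff_exists_Ioo_subset.trans ?_
  exact ⟨fun ⟨b, hb, h⟩ => ⟨b, hb, fun t h1 h2 => h ⟨h1, h2⟩⟩,
    fun ⟨b, hb, h⟩ => ⟨b, hb, fun t ht => h t ht.1 ht.2⟩⟩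

theorem frequently_nhdsGT {a : F} {P : F → Prop} :
    (∃ᶠ t in 𝓝[>] a, P t) ↔ ∀ b, a < b → ∃ t, a < t ∧ t < b ∧ P t := by
  simp [Filter.Frequently, eventually_nhdsGT]

end Filters

/-! ### Definable choice -/

section Choice

variable {L : FirstOrder.Language.{u, v}} {F : Type w} [L.Structure F]

variable (L F) in
/-- Definable choice for families of subsets of `B`. -/
def HasDefinableChoice (B : Type w) [DefinableSpace F B] : Prop :=
  ∀ ⦃A : Type w⦄ [DefinableSpace F A] ⦃R : Set (A × B)⦄, DefSet L F R →
    ∃ g : A → B, DefMap L F g ∧ ∀ a b, (a, b) ∈ R → (a, g a) ∈ R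

/-- Choose a first coordinate in the projection, then a second one in the fibre above it. -/
theorem HasDefinableChoice.prod {B C : Type w} [DefinableSpace F B] [DefinableSpace F C]
    (hB : HasDefinableChoice L F B) (hC : HasDefinableChoice L F C) :
    HasDefinableChoice L F (B × C) := by
  intro A _ R hR
  obtain ⟨g, hg, h⟩ := hB (R := {p : A × B | ∃ c, (p.1, (p.2, c)) ∈ R})
    (.defSet (by fun_prop (disch := assumption)))
  obtain ⟨g', hg', h'⟩ := hC (R := {p : A × C | (p.1, (g p.1, p.2)) ∈ R})
    (.defSet (by fun_prop (disch := assumption)))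
  refine ⟨fun a => (g a, g' a), by fun_prop, fun a b hab => ?_⟩
  obtain ⟨c, hc⟩ := h a b.1 ⟨b.2, hab⟩
  exact h' a c hc

theorem HasDefinableChoice.of_surjective {B C : Type w} [DefinableSpace F B] [DefinableSpace F C]
    (hB : HasDefinableChoice L F B) {e : B → C} (he : DefMap L F e) (hsurj : e.Surjective) :
    HasDefinableChoice L F C := by
  intro A _ R hR
  obtain ⟨g, hg, h⟩ := hB (R := {p : A × B | (p.1, e p.2) ∈ R})
    (.defSet (by fun_prop (disch := assumption)))
  refine ⟨fun a => e (g a), by fun_prop, fun a c hac => ?_⟩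
  obtain ⟨b, rfl⟩ := hsurj c
  exact h a b hac

theorem HasDefinableChoice.pi (hF : HasDefinableChoice L F F) (n : ℕ) :
    HasDefinableChoice L F (Fin n → F) := by
  induction n with
  | zero =>
    intro A _ R hR
    exact ⟨fun _ => Fin.elim0, .const _, fun a b hab => by rwa [Subsingleton.elim Fin.elim0 b]⟩
  | succ n ih =>
    refine (hF.prod ih).of_surjective (e := fun p => Fin.cons p.1 p.2) (.pi fun i => ?_)
      fun x => ⟨(x 0, Fin.tail x), Fin.cons_self_tail x⟩
    cases i using Fin.cases with
    | zero => simp only [Fin.cons_zero]; fun_prop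
    | succ i => simp only [Fin.cons_succ]; fun_prop

variable [Field F] [LinearOrder F] [IsOrderedFieldExpansion L F]

/-- Being a least upper bound is first-order and determines the point, so suprema vary definably;
elsewhere the value is unconstrained. -/
theorem IsDefinablyComplete.exists_isLUB_map (hcomplete : IsDefinablyComplete L F)
    {A : Type w} [DefinableSpace F A] {R : Set (A × F)} (hR : DefSet L F R) :
    ∃ u : A → F, DefMap L F u ∧ ∀ a, (∃ s, (a, s) ∈ R) → BddAbove {s | (a, s) ∈ R} →
      IsLUB {s | (a, s) ∈ R} (u a) := by
  obtain ⟨u, hu, h⟩ := exists_defMap_of_unique (L := L) (F := F)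
    (R := {p : A × F | (∀ s, (p.1, s) ∈ R → s ≤ p.2) ∧ ∀ c, (∀ s, (p.1, s) ∈ R → s ≤ c) → p.2 ≤ c})
    (.defSet (by fun_prop (disch := assumption)))
    (fun a b b' h h' => IsLUB.unique (s := {s | (a, s) ∈ R}) h h')
  refine ⟨u, hu, fun a hne hbdd => ?_⟩
  obtain ⟨s, hs⟩ := (hcomplete {s | (a, s) ∈ R}
    (DefPred.defSet (A := F) (by fun_prop (disch := assumption))) hne).1 hbdd
  rwa [h a s hs]

theorem IsDefinablyComplete.exists_isGLB_map (hcomplete : IsDefinablyComplete L F)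
    {A : Type w} [DefinableSpace F A] {R : Set (A × F)} (hR : DefSet L F R) :
    ∃ u : A → F, DefMap L F u ∧ ∀ a, (∃ s, (a, s) ∈ R) → BddBelow {s | (a, s) ∈ R} →
      IsGLB {s | (a, s) ∈ R} (u a) := by
  obtain ⟨u, hu, h⟩ := hcomplete.exists_isLUB_map (R := {p : A × F | ∀ s, (p.1, s) ∈ R → p.2 ≤ s})
    (.defSet (by fun_prop (disch := assumption)))
  exact ⟨u, hu, fun a hne hbdd => isLUB_lowerBounds.1
    (h a hbdd (hne.imp fun s hs c hc => hc s hs))⟩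

variable [IsStrictOrderedRing F]

-- If a set bounded below misses its infimum, the dichotomy puts an interval to the right of the
-- infimum inside the set; the midpoint of the longest such interval, truncated at length one, is a
-- canonical element.
open Classical in
theorem hasDefinableChoice_line [TopologicalSpace F] [OrderTopology F]
    (hcomplete : IsDefinablyComplete L F) (hlocal : IsLocallyOMinimal L F) :
    HasDefinableChoice L F F := by
  have nonneg {A : Type w} [DefinableSpace F A] {R : Set (A × F)} (hR : DefSet L F R)
      (hpos : ∀ a b, (a, b) ∈ R → 0 ≤ b) :
      ∃ g : A → F, DefMap L F g ∧ ∀ a b, (a, b) ∈ R → (a, g a) ∈ R := by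
    obtain ⟨i, hi, hglb⟩ := hcomplete.exists_isGLB_map hR
    -- The cap `i p.1 + 1` guarantees that the supremum exists in `F`.
    obtain ⟨u, hu, hlub⟩ := hcomplete.exists_isLUB_map (R := {p : A × F |
      i p.1 < p.2 ∧ p.2 ≤ i p.1 + 1 ∧ ∀ t, i p.1 < t → t < p.2 → (p.1, t) ∈ R})
      (.defSet (by fun_prop (disch := assumption)))
    refine ⟨fun a => if (a, i a) ∈ R then i a else (i a + u a) * 2⁻¹,
      by fun_prop (disch := assumption), fun a b hab => ?_⟩
    have hg := hglb a ⟨b, hab⟩ ⟨0, fun s hs => hpos a s hs⟩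
    dsimp only
    split_ifs with hmem
    · exact hmem
    have hev : ∀ᶠ t in 𝓝[>] i a, t ∈ {t | (a, t) ∈ R} := by
      refine hlocal.eventually_of_frequently (isOneSided_nhdsGT _)
        (.defSet (A := F) (by fun_prop (disch := assumption))) ?_
      refine frequently_nhdsGT.2 fun c hc => ?_
      obtain ⟨t, ht, h1, h2⟩ := hg.exists_between' hmem hc
      exact ⟨t, h1, h2, ht⟩
    obtain ⟨c, hc, hev⟩ := eventually_nhdsGT.1 hev
    have hl := hlub a ⟨min c (i a + 1), lt_min hc (lt_add_one _), min_le_right _ _,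
      fun t ht htc => hev t ht (lt_min_iff.1 htc).1⟩ ⟨i a + 1, fun t ht => ht.2.1⟩
    have hlt : i a < u a := (lt_min hc (lt_add_one _)).trans_le
      (hl.1 ⟨lt_min hc (lt_add_one _), min_le_right _ _,
        fun t ht htc => hev t ht (lt_min_iff.1 htc).1⟩)
    obtain ⟨c', hc', h⟩ := (lt_isLUB_iff hl).1
      (show (i a + u a) * 2⁻¹ < u a by rw [← div_eq_mul_inv]; linarith)
    exact hc'.2.2 _ (by rw [← div_eq_mul_inv]; linarith) h
  intro A _ R hR
  -- Arbitrary sets reduce to sets bounded below by choosing an absolute value first, then a sign.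
  obtain ⟨g, hg, h⟩ := nonneg (R := {p : A × F | 0 ≤ p.2 ∧ (p ∈ R ∨ (p.1, -p.2) ∈ R)})
    (.defSet (by fun_prop (disch := assumption))) fun a b h => h.1
  refine ⟨fun a => if (a, g a) ∈ R then g a else - g a, by fun_prop (disch := assumption),
    fun a b hab => ?_⟩
  have := (h a |b| (by
    refine ⟨abs_nonneg b, ?_⟩
    rcases abs_choice b with e | e <;> simp [e, hab])).2
  dsimp only
  split_ifs with hmem
  · exact hmem
  · exact this.resolve_left hmem

end Choice

/-! ### Left neighbourhoods and first-order continuity -/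

section Order

variable {F : Type w} [Field F] [LinearOrder F] [IsStrictOrderedRing F] [TopologicalSpace F]
  [OrderTopology F]

theorem eventually_nhdsLT {a : F} {P : F → Prop} :
    (∀ᶠ t in 𝓝[<] a, P t) ↔ ∃ b, b < a ∧ ∀ t, b < t → t < a → P t := by
  refine mem_nhdsLT_iff_exists_Ioo_subset.trans ?_
  exact ⟨fun ⟨b, hb, h⟩ => ⟨b, hb, fun t h1 h2 => h ⟨h1, h2⟩⟩,
    fun ⟨b, hb, h⟩ => ⟨b, hb, fun t ht => h t ht.1 ht.2⟩⟩

theorem continuousAt_iff_abs_sub_lt {g : F → F} {t : F} :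
    ContinuousAt g t ↔ ∀ ε > 0, ∃ ξ > 0, ∀ s, |s - t| < ξ → |g s - g t| < ε :=
  (nhds_basis_abs_sub_lt t).tendsto_iff (nhds_basis_abs_sub_lt (g t))

end Order

/-! ### Limits and continuity in one variable -/

section OneVariable

variable {L : FirstOrder.Language.{u, v}} {F : Type w} [L.Structure F] [Field F] [LinearOrder F]
  [IsStrictOrderedRing F] [IsOrderedFieldExpansion L F] [TopologicalSpace F] [OrderTopology F]

/-- The limit is the supremum of the eventual lower bounds of `g`; the dichotomy rules out
oscillation above it. -/
theorem exists_tendsto_nhdsGT (hcomplete : IsDefinablyComplete L F)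
    (hlocal : IsLocallyOMinimal L F) {g : F → F} (hg : DefMap L F g) {a c : F}
    (hb : ∀ᶠ t in 𝓝[>] a, |g t| ≤ c) : ∃ ℓ, Tendsto g (𝓝[>] a) (𝓝 ℓ) := by
  have hT (x : F) : x ∈ {x | ∃ b, a < b ∧ ∀ t, a < t → t < b → x ≤ g t} ↔
      ∀ᶠ t in 𝓝[>] a, x ≤ g t := eventually_nhdsGT.symm
  obtain ⟨ℓ, hℓ⟩ := (hcomplete {x | ∃ b, a < b ∧ ∀ t, a < t → t < b → x ≤ g t}
    (DefPred.defSet (A := F) (by fun_prop))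
    ⟨-c, (hT _).2 (hb.mono fun t ht => (abs_le.1 ht).1)⟩).1
    ⟨c, fun x hx => by
      obtain ⟨t, h1, h2⟩ := (((hT x).1 hx).and hb).exists
      exact h1.trans (abs_le.1 h2).2⟩
  refine ⟨ℓ, tendsto_order.2 ⟨fun x hx => ?_, fun x hx => ?_⟩⟩
  · obtain ⟨y, hy, hxy⟩ := (lt_isLUB_iff hℓ).1 hx
    exact ((hT y).1 hy).mono fun t ht => hxy.trans_le ht
  · obtain ⟨y, hy, hyx⟩ := exists_between hx
    have hS : DefSet L F {t | y ≤ g t} := .defSet (by fun_prop)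
    rcases hlocal.eventually_mem_or_notMem (isOneSided_nhdsGT a) hS with h | h
    · exact absurd (hℓ.1 ((hT y).2 h)) hy.not_ge
    · exact h.mono fun t ht => (not_le.1 ht).trans hyx

/-- A positive definable function on an interval is bounded away from zero on a subinterval. -/
theorem exists_Ioo_forall_le (hcomplete : IsDefinablyComplete L F)
    (hlocal : IsLocallyOMinimal L F) {h : F → F} (hh : DefMap L F h) {p q : F} (hpq : p < q)
    (hpos : ∀ t, p < t → t < q → 0 < h t) :
    ∃ δ > 0, ∃ p' q', p' < q' ∧ p ≤ p' ∧ q' ≤ q ∧ ∀ t, p' < t → t < q' → δ ≤ h t := by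
  by_contra! H
  -- Small values occur on every subinterval, so by the dichotomy each subinterval attains all
  -- sufficiently small positive values.
  have attained {c d : F} (hcd : c < d) (hpc : p ≤ c) (hdq : d ≤ q) :
      ∀ᶠ v in 𝓝[>] (0 : F), v ∈ {v | ∃ t, c < t ∧ t < d ∧ h t = v} := by
    refine hlocal.eventually_of_frequently (isOneSided_nhdsGT 0) (.defSet (by fun_prop))
      (frequently_nhdsGT.2 fun η hη => ?_)
    obtain ⟨t, h1, h2, h3⟩ := H η hη c d hcd hpc hdq
    exact ⟨h t, hpos t (hpc.trans_lt h1) (h2.trans_le hdq), h3, t, h1, h2, rfl⟩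
  obtain ⟨α, hα, hαR⟩ := hasDefinableChoice_line hcomplete hlocal (A := F)
    (R := {x : F × F | p < x.2 ∧ x.2 < q ∧ h x.2 = x.1}) (.defSet (by fun_prop))
  have hαv : ∀ᶠ v in 𝓝[>] (0 : F), p < α v ∧ α v < q ∧ h (α v) = v :=
    (attained hpq le_rfl le_rfl).mono fun v ⟨t, ht⟩ => hαR v t ht
  obtain ⟨ℓ, hℓ⟩ := exists_tendsto_nhdsGT hcomplete hlocal hα
    (hαv.mono fun v hv => abs_le_max_abs_abs hv.1.le hv.2.1.le)
  -- On this set `α` is a left inverse of `h`, so `h` is injective there. It contains `α v` for all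
  -- small `v`, hence a whole interval on one side of `ℓ`.
  have hA : DefSet L F {t | p < t ∧ t < q ∧ α (h t) = t} := .defSet (by fun_prop)
  have hαA : ∀ᶠ v in 𝓝[>] (0 : F), α v ∈ {t | p < t ∧ t < q ∧ α (h t) = t} :=
    hαv.mono fun v hv => ⟨hv.1, hv.2.1, by rw [hv.2.2]⟩
  have hne : ∀ᶠ v in 𝓝[>] (0 : F), α v ≠ ℓ := by
    have : ∀ᶠ v in 𝓝[>] (0 : F), v ≠ h ℓ := by
      rcases (isOneSided_nhdsGT (0 : F)).lt_or_gt (h ℓ) with h | h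
      · exact h.mono fun v hv => hv.ne
      · exact h.mono fun v hv => hv.ne'
    exact (this.and hαv).mono fun v hv e => hv.1 (by rw [← hv.2.2.2, e])
  obtain ⟨p', q', hpq', hsub⟩ : ∃ p' q', p' < q' ∧
      ∀ t, p' < t → t < q' → p < t ∧ t < q ∧ α (h t) = t := by
    rcases hlocal.eventually_mem_or_notMem (isOneSided_nhdsGT 0)
      (show DefSet L F {v | ℓ < α v} from .defSet (by fun_prop)) with hgt | hlt
    · have : Tendsto α (𝓝[>] 0) (𝓝[>] ℓ) := tendsto_nhdsWithin_iff.2 ⟨hℓ, hgt⟩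
      obtain ⟨b, hb, hb'⟩ := eventually_nhdsGT.1 (hlocal.eventually_of_frequently
        (isOneSided_nhdsGT ℓ) hA (this.frequently hαA.frequently))
      exact ⟨ℓ, b, hb, hb'⟩
    · have : Tendsto α (𝓝[>] 0) (𝓝[<] ℓ) := tendsto_nhdsWithin_iff.2
        ⟨hℓ, (hlt.and hne).mono fun v hv => lt_of_le_of_ne (not_lt.1 hv.1) hv.2⟩
      obtain ⟨b, hb, hb'⟩ := eventually_nhdsLT.1 (hlocal.eventually_of_frequently
        (isOneSided_nhdsLT ℓ) hA (this.frequently hαA.frequently))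
      exact ⟨b, ℓ, hb, hb'⟩
  -- Two disjoint subintervals attain a common small value, against injectivity.
  obtain ⟨m₁, h1, h2⟩ := exists_between hpq'
  obtain ⟨m₂, h3, h4⟩ := exists_between h2
  obtain ⟨m₃, h5, h6⟩ := exists_between h4
  obtain ⟨hp1, -, -⟩ := hsub m₁ h1 h2
  obtain ⟨hp2, hq2, -⟩ := hsub m₂ (h1.trans h3) h4
  obtain ⟨-, hq3, -⟩ := hsub m₃ (h1.trans (h3.trans h5)) h6
  obtain ⟨v, ⟨t, ht1, ht2, hv⟩, s, hs1, hs2, hv'⟩ :=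
    ((attained h3 hp1.le hq2.le).and (attained h5 hp2.le hq3.le)).exists
  have ht := (hsub t (h1.trans ht1) (ht2.trans h4)).2.2
  have hs := (hsub s (h1.trans (h3.trans hs1)) (hs2.trans h6)).2.2
  rw [hv] at ht
  rw [hv', ht] at hs
  exact (ht2.trans hs1).ne hs

/-- If `g` were discontinuous throughout, its jumps would be at least some fixed `δ` on a
subinterval, contradicting the right limit at that subinterval's left endpoint. -/
theorem exists_continuousAt (hcomplete : IsDefinablyComplete L F)
    (hlocal : IsLocallyOMinimal L F) {g : F → F} (hg : DefMap L F g) {p q c : F} (hpq : p < q)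
    (hb : ∀ t, p < t → t < q → |g t| ≤ c) : ∃ t, p < t ∧ t < q ∧ ContinuousAt g t := by
  by_contra! H
  obtain ⟨d, hd, hdR⟩ := hasDefinableChoice_line hcomplete hlocal (A := F)
    (R := {x : F × F | 0 < x.2 ∧ ∀ ξ > 0, ∃ s, |s - x.1| < ξ ∧ x.2 ≤ |g s - g x.1|})
    (.defSet (by fun_prop))
  have hdt (t) (h1 : p < t) (h2 : t < q) :
      0 < d t ∧ ∀ ξ > 0, ∃ s, |s - t| < ξ ∧ d t ≤ |g s - g t| := by
    have := H t h1 h2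
    rw [continuousAt_iff_abs_sub_lt] at this
    push Not at this
    obtain ⟨ε, hε⟩ := this
    exact hdR t ε hε
  obtain ⟨δ, hδ, p', q', hpq', hp, hq, hle⟩ :=
    exists_Ioo_forall_le hcomplete hlocal hd hpq fun t h1 h2 => (hdt t h1 h2).1
  obtain ⟨ℓ, hℓ⟩ := exists_tendsto_nhdsGT hcomplete hlocal hg (a := p') (c := c)
    (eventually_nhdsGT.2 ⟨q', hpq', fun t h1 h2 => hb t (hp.trans_lt h1) (h2.trans_le hq)⟩)
  obtain ⟨b, hpb, hbℓ⟩ := eventually_nhdsGT.1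
    (((nhds_basis_abs_sub_lt ℓ).tendsto_right_iff.1 hℓ) (δ / 2) (half_pos hδ))
  obtain ⟨t, h1, h2⟩ := exists_between (lt_min hpb hpq')
  obtain ⟨h2, h3⟩ := lt_min_iff.1 h2
  -- This radius keeps `s` in `(p', b)`, where `g` is within `δ / 2` of `ℓ`.
  obtain ⟨s, hs, hds⟩ := (hdt t (hp.trans_lt h1) (h3.trans_le hq)).2 (min (t - p') (b - t))
    (lt_min (sub_pos.2 h1) (sub_pos.2 h2))
  obtain ⟨hs1, hs2⟩ := lt_min_iff.1 hs
  have hsℓ := hbℓ s (by linarith [(abs_lt.1 hs1).1]) (by linarith [(abs_lt.1 hs2).2])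
  have htℓ := hbℓ t h1 h2
  have : |g s - g t| < δ := by
    rw [mem_ofPred_eq, abs_lt] at hsℓ htℓ
    rw [abs_lt]
    constructor <;> linarith [hsℓ.1, hsℓ.2, htℓ.1, htℓ.2]
  exact absurd ((hle t h1 h3).trans hds) this.not_ge

/-- Continuity points are definable and occur arbitrarily close to `a` on the right, so the
dichotomy applies. -/
theorem eventually_continuousAt_nhdsGT (hcomplete : IsDefinablyComplete L F)
    (hlocal : IsLocallyOMinimal L F) {g : F → F} (hg : DefMap L F g) {a c : F}
    (hb : ∀ᶠ t in 𝓝[>] a, |g t| ≤ c) : ∀ᶠ t in 𝓝[>] a, ContinuousAt g t := by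
  obtain ⟨b, hab, hb⟩ := eventually_nhdsGT.1 hb
  refine hlocal.eventually_of_frequently (S := {t | ContinuousAt g t}) (isOneSided_nhdsGT a) ?_
    (frequently_nhdsGT.2 fun b' hb' => ?_)
  · simp only [continuousAt_iff_abs_sub_lt]
    exact .defSet (by fun_prop)
  · obtain ⟨t, h1, h2, h3⟩ := exists_continuousAt hcomplete hlocal hg (lt_min hab hb')
      fun t h1 h2 => hb t h1 (lt_min_iff.1 h2).1
    exact ⟨t, h1, (lt_min_iff.1 h2).2, h3⟩

/-- A definable decreasing family of nonempty uniformly bounded sets has a common adherent point. -/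
theorem exists_forall_mem_closure (hcomplete : IsDefinablyComplete L F)
    (hlocal : IsLocallyOMinimal L F) {k : ℕ} {R : Set (F × (Fin k → F))} (hR : DefSet L F R)
    (hne : ∀ r > 0, ∃ x, (r, x) ∈ R) (hmono : ∀ r s x, r ≤ s → (r, x) ∈ R → (s, x) ∈ R)
    (hb : ∃ c, ∀ r > 0, ∀ x, (r, x) ∈ R → ∀ i, |x i| ≤ c) :
    ∃ x, ∀ r > 0, x ∈ closure {x | (r, x) ∈ R} := by
  -- The adherent point is the coordinatewise limit of a definable selection as `r` tends to zero
  -- from above.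
  obtain ⟨γ, hγ, hγR⟩ := (hasDefinableChoice_line hcomplete hlocal).pi k hR
  obtain ⟨c, hc⟩ := hb
  have hγR' (r) (hr : 0 < r) : (r, γ r) ∈ R := (hne r hr).elim (hγR r)
  have hlim (i) := exists_tendsto_nhdsGT hcomplete hlocal (g := fun r => γ r i) (by fun_prop)
    (eventually_mem_nhdsWithin.mono fun r hr => hc r hr _ (hγR' r hr) i)
  choose x hx using hlim
  refine ⟨x, fun r hr => mem_closure_of_tendsto (tendsto_pi_nhds.2 hx) ?_⟩
  exact eventually_nhdsGT.2 ⟨r, hr, fun t h1 h2 => hmono t r _ h2.le (hγR' t h1)⟩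

end OneVariable

/-! ### Closed bounded curves ending at a frontier point -/

section SeveralVariables

variable {F : Type w} [Field F] [LinearOrder F] [IsStrictOrderedRing F] [TopologicalSpace F]
  [OrderTopology F]

theorem mem_closure_iff_abs_sub_le {k : ℕ} {S : Set (Fin k → F)} {y : Fin k → F} :
    y ∈ closure S ↔ ∀ r > 0, ∃ x ∈ S, ∀ i, |x i - y i| ≤ r := by
  refine ⟨fun h r hr => ?_, fun h => ?_⟩
  · have : ∀ᶠ x in 𝓝 y, ∀ i, |x i - y i| < r := eventually_all.2 fun i =>
      (continuous_apply i).continuousAt.eventually (eventually_abs_sub_lt (y i) hr)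
    obtain ⟨x, hx, hxS⟩ := ((mem_closure_iff_frequently.1 h).and_eventually this).exists
    exact ⟨x, hx, fun i => (hxS i).le⟩
  · choose! x hxS hx using h
    refine mem_closure_of_tendsto (f := x) (b := 𝓝[>] 0) (tendsto_pi_nhds.2 fun i => ?_)
      (eventually_mem_nhdsWithin.mono hxS)
    refine (nhds_basis_abs_sub_lt (y i)).tendsto_right_iff.2 fun ε hε => ?_
    exact eventually_nhdsGT.2 ⟨ε, hε, fun t h1 h2 => (hx t h1 i).trans_lt h2⟩

theorem isClosed_forall_abs_sub_le {k : ℕ} (y : Fin k → F) (r : F) :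
    IsClosed {x : Fin k → F | ∀ i, |x i - y i| ≤ r} := by
  simp only [Set.ofPred_forall]
  exact isClosed_iInter fun i => isClosed_le (by fun_prop) continuous_const

variable {L : FirstOrder.Language.{u, v}} [L.Structure F] [IsOrderedFieldExpansion L F]

/-- A point of the frontier of a definable set `B` is the limit of a definable continuous curve in
`B`; the curve together with its limit is closed and bounded. -/
theorem exists_isClosed_subset_insert (hcomplete : IsDefinablyComplete L F)
    (hlocal : IsLocallyOMinimal L F) {k : ℕ} {B : Set (Fin k → F)} (hB : DefSet L F B)
    {y : Fin k → F} (hy : y ∈ closure B) (hyB : y ∉ B) :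
    ∃ K : Set (Fin k → F), DefSet L F K ∧ IsClosed K ∧ IsBoundedSet K ∧ K ⊆ insert y B ∧
      y ∈ closure (K ∩ B) := by
  -- The squared distance to `y` is polynomial, hence definable and continuous. It parametrises the
  -- curve: `q (γ t) = t`.
  set q : (Fin k → F) → F := fun z => ∑ i, (z i - y i) * (z i - y i) with hq
  have hqdef : DefMap L F q := by fun_prop
  have hqcont : Continuous q := by fun_prop
  have hqi (z) (i) : (z i - y i) * (z i - y i) ≤ q z :=
    Finset.single_le_sum (f := fun i => (z i - y i) * (z i - y i))
      (fun i _ => mul_self_nonneg _) (Finset.mem_univ i)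
  have hqy : q y = 0 := by simp [hq]
  have hqpos (z) (hz : z ≠ y) : 0 < q z := by
    obtain ⟨i, hi⟩ := Function.ne_iff.1 hz
    exact (mul_self_pos.2 (sub_ne_zero.2 hi)).trans_le (hqi z i)
  have habs (z r) (hr : 0 ≤ r) (h : q z ≤ r * r) (i) : |z i - y i| ≤ r :=
    abs_le_of_sq_le_sq (by rw [pow_two, pow_two]; exact (hqi z i).trans h) hr
  obtain ⟨γ, hγ, hγR⟩ := (hasDefinableChoice_line hcomplete hlocal).pi k (A := F)
    (R := {p : F × (Fin k → F) | p.2 ∈ B ∧ q p.2 = p.1})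
    (.defSet (by fun_prop (disch := assumption)))
  have hγB : ∀ᶠ t in 𝓝[>] (0 : F), γ t ∈ B ∧ q (γ t) = t := by
    have : ∀ᶠ t in 𝓝[>] (0 : F), t ∈ {t | ∃ z, z ∈ B ∧ q z = t} := by
      refine hlocal.eventually_of_frequently (isOneSided_nhdsGT 0)
        (.defSet (by fun_prop (disch := assumption))) (frequently_nhdsGT.2 fun η hη => ?_)
      have : ∀ᶠ z in 𝓝 y, q z < η := hqcont.continuousAt.eventually_lt_const (by rwa [hqy])
      obtain ⟨z, hz, hzη⟩ := ((mem_closure_iff_frequently.1 hy).and_eventually this).exists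
      exact ⟨q z, hqpos z fun e => hyB (e ▸ hz), hzη, z, hz, rfl⟩
    exact this.mono fun t ⟨z, hz⟩ => hγR t z hz
  have hγc : ∀ᶠ t in 𝓝[>] (0 : F), ∀ i, ContinuousAt (fun t => γ t i) t := by
    refine eventually_all.2 fun i => eventually_continuousAt_nhdsGT hcomplete hlocal
      (c := |y i| + 1) (by fun_prop) ?_
    refine (hγB.and (eventually_nhdsGT.2 ⟨1, one_pos, fun t _ h => h⟩)).mono fun t ht => ?_
    have := habs (γ t) 1 zero_le_one (by rw [ht.1.2, one_mul]; exact ht.2.le) i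
    have h' := abs_add_le (y i) (γ t i - y i)
    rw [add_sub_cancel] at h'
    linarith
  obtain ⟨b, hb, hγb⟩ := eventually_nhdsGT.1 (hγB.and hγc)
  -- Stopping at `b' < b` keeps the included endpoint `γ b'` within the range of continuity.
  obtain ⟨b', hb', hbb'⟩ := exists_between hb
  have hK (z) (hz : z ∈ {z | z = y ∨ ∃ t, 0 < t ∧ t ≤ b' ∧ γ t = z}) : q z ≤ b' := by
    rcases hz with rfl | ⟨t, h1, h2, rfl⟩
    · rw [hqy]; exact hb'.le
    · rw [(hγb t h1 (h2.trans_lt hbb')).1.2]; exact h2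
  refine ⟨{z | z = y ∨ ∃ t, 0 < t ∧ t ≤ b' ∧ γ t = z}, .defSet (by fun_prop),
    isClosed_of_closure_subset fun z hz => ?_, ⟨∑ i, |y i| + (b' + 1), fun z hz i => ?_⟩, ?_, ?_⟩
  · rcases eq_or_ne z y with rfl | hzy
    · exact .inl rfl
    have hzb : q z ≤ b' := closure_minimal hK (isClosed_le hqcont continuous_const) hz
    -- The identity `γ (q w) = w` holds along the curve and passes to limits `z ≠ y`, so `z` is on
    -- the curve.
    have hcont : Tendsto (fun w => γ (q w)) (𝓝 z) (𝓝 (γ (q z))) :=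
      ContinuousAt.comp (f := q) (g := γ)
        (continuousAt_pi.2 (hγb (q z) (hqpos z hzy) (hzb.trans_lt hbb')).2) hqcont.continuousAt
    have hfreq : ∃ᶠ w in 𝓝 z, γ (q w) = w := by
      refine ((mem_closure_iff_frequently.1 hz).and_eventually
        (isOpen_ne.mem_nhds hzy)).mono ?_
      rintro w ⟨rfl | ⟨t, h1, h2, rfl⟩, hw⟩
      · exact absurd rfl hw
      · rw [(hγb t h1 (h2.trans_lt hbb')).1.2]
    exact .inr ⟨q z, hqpos z hzy, hzb, tendsto_nhds_unique_of_frequently_eq hcont tendsto_id hfreq⟩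
  · have h1 := habs z (b' + 1) (by linarith) (by nlinarith [hK z hz]) i
    have h2 := abs_add_le (y i) (z i - y i)
    rw [add_sub_cancel] at h2
    have h3 : |y i| ≤ ∑ j, |y j| :=
      Finset.single_le_sum (f := fun j => |y j|) (fun j _ => abs_nonneg _) (Finset.mem_univ i)
    linarith
  · rintro z (rfl | ⟨t, h1, h2, rfl⟩)
    · exact mem_insert _ _
    · exact mem_insert_of_mem _ (hγb t h1 (h2.trans_lt hbb')).1.1
  · refine mem_closure_iff_abs_sub_le.2 fun r hr => ?_
    have ht : 0 < min b' (r * r) := lt_min hb' (mul_pos hr hr)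
    have hγt := hγb _ ht ((min_le_left _ _).trans_lt hbb')
    exact ⟨γ (min b' (r * r)), ⟨.inr ⟨_, ht, min_le_left _ _, rfl⟩, hγt.1.1⟩,
      habs _ r hr.le (hγt.1.2.trans_le (min_le_right _ _))⟩

end SeveralVariables

/-! ### The two implications -/

section Maps

variable {L : FirstOrder.Language.{u, v}} {F : Type w} [L.Structure F] {m n : ℕ}
  {X : Set (Fin m → F)} {Y : Set (Fin n → F)} {f : X → Y}

/-- The graph of a map between subsets of powers of `F`. -/
def graphIn (f : X → Y) : Set ((Fin m → F) × (Fin n → F)) :=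
  {p | ∃ x : X, (x : Fin m → F) = p.1 ∧ (f x : Fin n → F) = p.2}

theorem IsDefinableMap.defSet_graphIn (hf : IsDefinableMap L f) : DefSet L F (graphIn f) := by
  unfold IsDefinableMap at hf
  have : DefPred L F fun p : (Fin m → F) × (Fin n → F) => ∃ x : X, p.1 = x ∧ p.2 = f x := hf
  simpa only [DefSet, graphIn, mem_ofPred_eq, eq_comm] using this

theorem IsDefinableMap.defSet_preimageIn (hf : IsDefinableMap L f) {K : Set (Fin n → F)}
    (hK : DefSet L F K) : DefSet L F (preimageIn f K) := by
  have hG := hf.defSet_graphIn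
  have : preimageIn f K = {x | ∃ y, (x, y) ∈ graphIn f ∧ y ∈ K} := by
    ext x
    constructor
    · rintro ⟨hx, h⟩
      exact ⟨_, ⟨⟨x, hx⟩, rfl, rfl⟩, h⟩
    · rintro ⟨_, ⟨x, rfl, rfl⟩, h⟩
      exact ⟨x.2, h⟩
  rw [this]
  exact .defSet (by fun_prop (disch := assumption))

variable [Field F] [LinearOrder F] [IsStrictOrderedRing F] [TopologicalSpace F]
  [OrderTopology F] [IsOrderedFieldExpansion L F]

/-- The images in `K` have a common adherent point `y`. Since `K ⊆ Y`, closedness of the image in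
`Y` puts `y` in `f` of each member of the family. -/
theorem IsDefinablyClosedMap.exists_fibre (hcomplete : IsDefinablyComplete L F)
    (hlocal : IsLocallyOMinimal L F) (hX : DefSet L F X) (hf : IsDefinableMap L f)
    (hclosed : IsDefinablyClosedMap L f) {K : Set (Fin n → F)} (hK : DefSet L F K) (hKY : K ⊆ Y)
    (hKc : IsClosed K) (hKb : IsBoundedSet K) {R : Set (F × (Fin m → F))} (hR : DefSet L F R)
    (hRc : ∀ r > 0, IsClosed {x | (r, x) ∈ R})
    (hmono : ∀ r s x, r ≤ s → (r, x) ∈ R → (s, x) ∈ R)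
    (hne : ∀ r > 0, ∃ x ∈ preimageIn f K, (r, x) ∈ R) :
    ∃ y : Y, (y : Fin n → F) ∈ K ∧ ∀ r > 0, ∃ x ∈ preimageIn f {(y : Fin n → F)}, (r, x) ∈ R := by
  have hG := hf.defSet_graphIn
  obtain ⟨c, hc⟩ := hKb
  obtain ⟨y, hy⟩ := exists_forall_mem_closure hcomplete hlocal
    (R := {p : F × (Fin n → F) | p.2 ∈ K ∧ ∃ x, (x, p.2) ∈ graphIn f ∧ (p.1, x) ∈ R})
    (.defSet (by fun_prop (disch := assumption)))
    (fun r hr => by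
      obtain ⟨x, ⟨hx, hxK⟩, hxR⟩ := hne r hr
      exact ⟨_, hxK, x, ⟨⟨x, hx⟩, rfl, rfl⟩, hxR⟩)
    (fun r s y hrs ⟨hyK, x, hxy, hxR⟩ => ⟨hyK, x, hxy, hmono r s x hrs hxR⟩)
    ⟨c, fun r _ y hy => hc y hy.1⟩
  have hyK : y ∈ K := closure_minimal (fun z hz => hz.1) hKc (hy 1 one_pos)
  refine ⟨⟨y, hKY hyK⟩, hyK, fun r hr => ?_⟩
  have hC : IsClosed (f '' {x : X | (r, (x : Fin m → F)) ∈ R}) := by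
    refine hclosed _ ?_ ((hRc r hr).preimage continuous_subtype_val)
    have : Subtype.val '' {x : X | (r, (x : Fin m → F)) ∈ R} = {x | x ∈ X ∧ (r, x) ∈ R} := by
      ext x
      simp [and_comm]
    rw [this]
    exact DefPred.defSet (L := L) (F := F) (P := fun x => x ∈ X ∧ (r, x) ∈ R)
      (by fun_prop (disch := assumption))
  have hmem : (⟨y, hKY hyK⟩ : Y) ∈ closure (f '' {x : X | (r, (x : Fin m → F)) ∈ R}) := by
    refine closure_subtype.2 (closure_mono ?_ (hy r hr))
    rintro z ⟨-, _, ⟨x, rfl, rfl⟩, hxR⟩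
    exact ⟨_, ⟨x, hxR, rfl⟩, rfl⟩
  rw [hC.closure_eq] at hmem
  obtain ⟨x, hxR, hxy⟩ := hmem
  exact ⟨x, ⟨x.2, by simp [hxy]⟩, hxR⟩

theorem IsDefinablyClosedMap.isDefinablyProper (hcomplete : IsDefinablyComplete L F)
    (hlocal : IsLocallyOMinimal L F) (hX : DefSet L F X) (hf : IsDefinableMap L f)
    (hclosed : IsDefinablyClosedMap L f)
    (hfib : ∀ y : Y, IsClosed (preimageIn f {(y : Fin n → F)}) ∧
      IsBoundedSet (preimageIn f {(y : Fin n → F)})) : IsDefinablyProper L f := by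
  intro K hK hKY hKc hKb
  constructor
  · refine isClosed_of_closure_subset fun x₀ hx₀ => ?_
    obtain ⟨y, hyK, hy⟩ := hclosed.exists_fibre hcomplete hlocal hX hf hK hKY hKc hKb
      (R := {p : F × (Fin m → F) | ∀ i, |p.2 i - x₀ i| ≤ p.1}) (.defSet (by fun_prop))
      (fun r _ => isClosed_forall_abs_sub_le x₀ r) (fun r s x hrs hx i => (hx i).trans hrs)
      (mem_closure_iff_abs_sub_le.1 hx₀)
    have := mem_closure_iff_abs_sub_le.2 hy
    rw [(hfib y).1.closure_eq] at this
    obtain ⟨hx, hxy⟩ := this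
    exact ⟨hx, by rw [mem_singleton_iff.1 hxy]; exact hyK⟩
  · by_contra hunb
    unfold IsBoundedSet at hunb
    push Not at hunb
    -- For `r > 0` the condition reads `|x i| ≥ r⁻¹` for some `i`; the product form is monotone in
    -- every `r`.
    obtain ⟨y, -, hy⟩ := hclosed.exists_fibre hcomplete hlocal hX hf hK hKY hKc hKb
      (R := {p : F × (Fin m → F) | ∃ i, 1 ≤ p.1 * |p.2 i|}) (.defSet (by fun_prop))
      (fun r _ => by
        have : {x : Fin m → F | ∃ i, 1 ≤ r * |x i|} = ⋃ i, {x | 1 ≤ r * |x i|} := by ext; simp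
        exact this ▸ isClosed_iUnion_of_finite fun i => isClosed_le continuous_const
          (continuous_const.mul (continuous_apply i).abs))
      (fun r s x hrs ⟨i, hi⟩ => ⟨i, hi.trans (mul_le_mul_of_nonneg_right hrs (abs_nonneg _))⟩)
      (fun r hr => by
        obtain ⟨x, hx, i, hi⟩ := hunb r⁻¹
        exact ⟨x, hx, i, (inv_le_iff_one_le_mul₀' hr).1 hi.le⟩)
    obtain ⟨c, hc⟩ := (hfib y).2
    have hpos : 0 < |c| + 1 := by positivity
    obtain ⟨x, hx, i, hi⟩ := hy (|c| + 1)⁻¹ (inv_pos.2 hpos)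
    have h1 := hc x hx i
    have h2 := (one_le_inv_mul₀ hpos).1 hi
    linarith [le_abs_self c]

theorem IsDefinablyProper.isDefinablyClosedMap (hcomplete : IsDefinablyComplete L F)
    (hlocal : IsLocallyOMinimal L F) (hf : IsDefinableMap L f) (hcont : Continuous f)
    (hproper : IsDefinablyProper L f) : IsDefinablyClosedMap L f := by
  intro C hCdef hC
  have hG := hf.defSet_graphIn
  have hCdef : DefSet L F (Subtype.val '' C) := hCdef
  refine isClosed_of_closure_subset fun y hy => by_contra fun hyC => ?_
  have hB : DefSet L F (Subtype.val '' (f '' C)) := by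
    have : Subtype.val '' (f '' C) = {z | ∃ x ∈ Subtype.val '' C, (x, z) ∈ graphIn f} := by
      ext z
      constructor
      · rintro ⟨_, ⟨x, hx, rfl⟩, rfl⟩
        exact ⟨x, ⟨x, hx, rfl⟩, x, rfl, rfl⟩
      · rintro ⟨_, ⟨x, hx, rfl⟩, x', hxx', rfl⟩
        exact ⟨_, ⟨x, hx, rfl⟩, by rw [Subtype.ext hxx']⟩
    rw [this]
    exact .defSet (by fun_prop (disch := assumption))
  obtain ⟨K, hKdef, hKc, hKb, hKB, hyK⟩ := exists_isClosed_subset_insert hcomplete hlocal hB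
    (closure_subtype.1 hy) (by rwa [Subtype.val_injective.mem_set_image])
  have hKY : K ⊆ Y := hKB.trans (insert_subset y.2 (Subtype.coe_image_subset _ _))
  obtain ⟨hPc, c, hPb⟩ := hproper K hKdef hKY hKc hKb
  have hPdef := hf.defSet_preimageIn hKdef
  obtain ⟨x, hx⟩ := exists_forall_mem_closure hcomplete hlocal
    (R := {p : F × (Fin m → F) | (p.2 ∈ preimageIn f K ∧ p.2 ∈ Subtype.val '' C) ∧
      ∃ z, (p.2, z) ∈ graphIn f ∧ ∀ i, |z i - (y : Fin n → F) i| ≤ p.1})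
    (.defSet (by fun_prop (disch := assumption)))
    (fun r hr => by
      obtain ⟨_, ⟨hzK, _, ⟨x, hxC, rfl⟩, rfl⟩, hz⟩ := mem_closure_iff_abs_sub_le.1 hyK r hr
      exact ⟨x, ⟨⟨x.2, hzK⟩, x, hxC, rfl⟩, _, ⟨x, rfl, rfl⟩, hz⟩)
    (fun r s x hrs ⟨hx, z, hz, h⟩ => ⟨hx, z, hz, fun i => (h i).trans hrs⟩)
    ⟨c, fun r _ x hx => hPb x hx.1.1⟩
  -- Closedness of `f⁻¹(K)` in the ambient space places `x` in `X`; only then is closedness of `C`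
  -- relative to `X` usable.
  obtain ⟨hxX, -⟩ : x ∈ preimageIn f K := closure_minimal (fun z hz => hz.1.1) hPc (hx 1 one_pos)
  have hsub (r : F) (hr : 0 < r) : (⟨x, hxX⟩ : X) ∈
      C ∩ {x' | ∀ i, |(f x' : Fin n → F) i - (y : Fin n → F) i| ≤ r} := by
    have hcl : IsClosed (C ∩ {x' | ∀ i, |(f x' : Fin n → F) i - (y : Fin n → F) i| ≤ r}) :=
      hC.inter ((isClosed_forall_abs_sub_le (y : Fin n → F) r).preimage
        (continuous_subtype_val.comp hcont))
    rw [← hcl.closure_eq]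
    refine closure_subtype.2 (closure_mono ?_ (hx r hr))
    rintro _ ⟨⟨-, x', hx', rfl⟩, _, ⟨x'', hx'', rfl⟩, h⟩
    rw [Subtype.ext hx''] at h
    exact ⟨x', ⟨hx', h⟩, rfl⟩
  refine hyC ⟨⟨x, hxX⟩, (hsub 1 one_pos).1, Subtype.ext (funext fun i => ?_)⟩
  refine sub_eq_zero.1 (abs_nonpos_iff.1 (le_of_forall_pos_le_add fun r hr => ?_))
  rw [zero_add]
  exact (hsub r hr).2 i

end Maps

end LocallyOMinimal

theorem mainTheorem10 {L : FirstOrder.Language.{u, v}} {F : Type w}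
    [Field F] [LinearOrder F] [IsStrictOrderedRing F] [TopologicalSpace F] [OrderTopology F]
    [L.Structure F] [LocallyOMinimal.IsOrderedFieldExpansion L F]
    (hcomplete : LocallyOMinimal.IsDefinablyComplete L F)
    (hlocal : LocallyOMinimal.IsLocallyOMinimal L F)
    {m n : ℕ} {X : Set (Fin m → F)} {Y : Set (Fin n → F)}
    (hX : LocallyOMinimal.IsDefinable L X) (hY : LocallyOMinimal.IsDefinable L Y)
    (f : X → Y) (hf : LocallyOMinimal.IsDefinableMap L f) (hcont : Continuous f) :
    LocallyOMinimal.IsDefinablyProper L f ↔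
      LocallyOMinimal.IsDefinablyClosedMap L f ∧
        ∀ y : Y, IsClosed (LocallyOMinimal.preimageIn f {(y : Fin n → F)}) ∧
          LocallyOMinimal.IsBoundedSet (LocallyOMinimal.preimageIn f {(y : Fin n → F)}) := by
  refine ⟨fun h => ⟨h.isDefinablyClosedMap hcomplete hlocal hf hcont, fun y => ?_⟩,
    fun h => h.1.isDefinablyProper hcomplete hlocal hX hf h.2⟩
  refine h _ ?_ (Set.singleton_subset_iff.2 y.2) isClosed_singleton
    ⟨∑ i, |(y : Fin n → F) i|, fun x hx i => ?_⟩
  · exact LocallyOMinimal.DefPred.defSet (A := Fin n → F) (F := F)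
      (P := fun x => x = (y : Fin n → F)) (by fun_prop)
  · rw [Set.mem_singleton_iff.1 hx]
    exact Finset.single_le_sum (f := fun j => |(y : Fin n → F) j|) (fun j _ => abs_nonneg _)
      (Finset.mem_univ i)
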